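/- Let $\Gamma$ be a connected compact metric graph: a finite connected graph without loops or multiple edges, each edge ${\bf e}$ having a length $\ell_{\bf e}\in(0,\infty)$ and being identified with $[0,\ell_{\bf e}]$, running from its initial vertex ${\rm i}_{\bf e}$ to its terminal vertex ${\rm f}_{\bf e}$. A function $u$ on $\Gamma$ is a family $([u]_{\bf e})_{\bf e}$ of functions on $(0,\ell_{\bf e})$; $\int_\Gamma u=\sum_{\bf e}\int_0^{\ell_{\bf e}}[u]_{\bf e}$, $\ell(A)=\int_\Gamma\chi_A$ for measurable $A\subset\Gamma$, and $L^p(\Gamma)$, $BV(\Gamma)$, $W^{1,2}(\Gamma)$ are defined edge by edge, with no condition at the vertices. For ${\bf z}\in W^{1,2}(\Gamma)$ and a vertex ${\bf v}$ of ${\bf e}$ put $[{\bf z}]_{\bf e}({\bf v})=[{\bf z}]_{\bf e}(\ell_{\bf e})$ if ${\bf v}={\rm f}_{\bf e}$ and $[{\bf z}]_{\bf e}({\bf v})=-[{\bf z}]_{\bf e}(0)$ if ${\bf v}={\rm i}_{\bf e}$ (continuous representative), and let $X_K(\Gamma)$ be the set of ${\bf z}\in W^{1,2}(\Gamma)$ with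 $\sum_{{\bf e}\ni{\bf v}}[{\bf z}]_{\bf e}({\bf v})=0$ for every vertex ${\bf v}$. For $u\in BV(\Gamma)$ let $$TV_\Gamma(u)=\sup\Big\{\Big|\int_\Gamma u\,{\bf z}'\Big| : {\bf z}\in X_K(\Gamma),\ \|{\bf z}\|_{L^\infty(\Gamma)}\le 1\Big\}.$$ A measurable set $E\subset\Gamma$ has finite perimeter if $\chi_E\in BV(\Gamma)$, and then ${\rm Per}_\Gamma(E)=TV_\Gamma(\chi_E)$. Let $\mathcal F_\Gamma:L^2(\Gamma)\to[0,\infty]$ be $TV_\Gamma$ on $BV(\Gamma)$ and $+\infty$ elsewhere, let $\partial\mathcal F_\Gamma$ be its subdifferential in $L^2(\Gamma)$, and define the (multivalued) $1$-Laplacian by $-\Delta_1^\Gamma u=\partial\mathcal F_\Gamma(u)$. A pair $(\lambda,u)\in\mathbb R\times BV(\Gamma)$ is a $\Gamma$-eigenpair of $-\Delta_1^\Gamma$ if $\|u\|_{L^1(\Gamma)}=1$ and $\lambda\xi\in\partial\mathcal F_\Gamma(u)$ for some $\xi\in{\rm sign}(u)$, where ${\rm sign}(r)$ is $\{1\}$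 for $r>0$, $\{-1\}$ for $r<0$ and $[-1,1]$ for $r=0$. Let $\Omega\subset\Gamma$ be measurable with $\ell(\Omega)>0$, and put $\lambda_\Omega^\Gamma={\rm Per}_\Gamma(\Omega)/\ell(\Omega)$. If $\big(\lambda_\Omega^\Gamma,\tfrac1{\ell(\Omega)}\chi_\Omega\big)$ is a $\Gamma$-eigenpair of $-\Delta_1^\Gamma$, then $\Omega$ is $\Gamma$-calibrable, that is, $\Omega$ has finite perimeter and $$\frac{{\rm Per}_\Gamma(\Omega)}{\ell(\Omega)}=h_1^\Gamma(\Omega):=\inf\Big\{\frac{{\rm Per}_\Gamma(E)}{\ell(E)} : E\subset\Omega \text{ of finite perimeter},\ \ell(E)>0\Big\}.$$ -/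

import Mathlib

open MeasureTheory Set
open scoped ENNReal ContDiff

noncomputable section

/-! ### Functions of one variable on the interval `(0, L)` -/

/-- Lebesgue measure on the open interval `(0, L)`. -/
def intervalMeasure (L : ℝ) : Measure ℝ := volume.restrict (Ioo 0 L)

/-- Test functions on `(0, L)`: smooth functions with compact support contained in `(0, L)`. -/
def IsTestFunction (L : ℝ) (φ : ℝ → ℝ) : Prop :=
  ContDiff ℝ ∞ φ ∧ HasCompactSupport φ ∧ tsupport φ ⊆ Ioo 0 L

/-- `f ∈ BV(0, L)`: `f ∈ L¹(0, L)` and the distributional derivative of `f` is a finite signed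
measure, written as a difference `μ - ν` of two finite positive measures. -/
def MemBVInterval (L : ℝ) (f : ℝ → ℝ) : Prop :=
  MemLp f 1 (intervalMeasure L) ∧
    ∃ μ ν : Measure ℝ, IsFiniteMeasure μ ∧ IsFiniteMeasure ν ∧
      ∀ φ : ℝ → ℝ, IsTestFunction L φ →
        ∫ t, f t * deriv φ t ∂(intervalMeasure L) = -((∫ t, φ t ∂μ) - ∫ t, φ t ∂ν)

/-- `g` is the weak derivative of `f` on `(0, L)`. -/
def IsWeakDeriv (L : ℝ) (f g : ℝ → ℝ) : Prop :=
  ∀ φ : ℝ → ℝ, IsTestFunction L φ →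
    ∫ t, f t * deriv φ t ∂(intervalMeasure L) = -∫ t, g t * φ t ∂(intervalMeasure L)

/-- `f` is (the continuous representative on `[0, L]` of) an element of `W^{1,2}(0, L)`, with weak
derivative `g`. Every element of `W^{1,2}(0, L)` has exactly one such representative; its values
at `0` and `L` are the boundary values of the element. -/
def IsSobolevRep (L : ℝ) (f g : ℝ → ℝ) : Prop :=
  ContinuousOn f (Icc 0 L) ∧ MemLp f 2 (intervalMeasure L) ∧ MemLp g 2 (intervalMeasure L) ∧
    IsWeakDeriv L f g

/-- The multivalued sign: `{1}` on positive numbers, `{-1}` on negative ones, `[-1, 1]` at `0`. -/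
def signSet (r : ℝ) : Set ℝ :=
  if 0 < r then {1} else if r < 0 then {-1} else Icc (-1) 1

/-! ### Metric graphs -/

/-- A connected metric graph on the vertex set `V` without loops or multiple edges, all of whose
edges have finite length. It is compact when `V` is finite. Each edge `e` is identified with an
ordered pair `(initial e, terminal e)`. -/
structure MetricGraph (V : Type*) where
  /-- the underlying combinatorial graph -/
  graph : SimpleGraph V
  connected : graph.Connected
  /-- the initial vertex of an edge -/
  initial : graph.edgeSet → V
  /-- the terminal vertex of an edge -/
  terminal : graph.edgeSet → V
  ends_eq : ∀ e : graph.edgeSet, s(initial e, terminal e) = (e : Sym2 V)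
  /-- the length of an edge -/
  edgeLength : graph.edgeSet → ℝ
  edgeLength_pos : ∀ e, 0 < edgeLength e

namespace MetricGraph

variable {V : Type*}

/-- The edges of the metric graph. -/
abbrev Edge (Γ : MetricGraph V) : Type _ := Γ.graph.edgeSet

instance instFintypeEdge [Finite V] (Γ : MetricGraph V) : Fintype Γ.Edge := Fintype.ofFinite _

/-- The points of the metric graph: its vertices and the interior points of its edges, an interior
point of `e` being given by its coordinate in `(0, ℓ_e)`. -/
inductive Point (Γ : MetricGraph V) : Type _
  | vertex (v : V) : Point Γ
  | interior (e : Γ.Edge) (t : Ioo (0 : ℝ) (Γ.edgeLength e)) : Point Γ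

/-- The point of the (closed) edge `e` with coordinate `t ∈ [0, ℓ_e]`: this is `c_e⁻¹ (t)`. -/
def pointAt (Γ : MetricGraph V) (e : Γ.Edge) (t : Icc (0 : ℝ) (Γ.edgeLength e)) : Γ.Point :=
  if h0 : (t : ℝ) = 0 then Point.vertex (Γ.initial e)
  else if h1 : (t : ℝ) = Γ.edgeLength e then Point.vertex (Γ.terminal e)
  else Point.interior e ⟨t, lt_of_le_of_ne t.2.1 (Ne.symm h0), lt_of_le_of_ne t.2.2 h1⟩

/-- The set `c_e (A ∩ e) ⊆ [0, ℓ_e]` of coordinates of the points of `A` on the edge `e`. -/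
def coords (Γ : MetricGraph V) (A : Set Γ.Point) (e : Γ.Edge) : Set ℝ :=
  {t | ∃ ht : t ∈ Icc (0 : ℝ) (Γ.edgeLength e), Γ.pointAt e ⟨t, ht⟩ ∈ A}

/-- Lebesgue measurability of a subset of the metric graph. -/
def IsMeasurable (Γ : MetricGraph V) (A : Set Γ.Point) : Prop :=
  ∀ e, NullMeasurableSet (Γ.coords A e) volume

/-- A function on the metric graph is a collection of functions `[u]_e` of the edge coordinate,
of which only the values on `(0, ℓ_e)` are relevant. -/
abbrev Fn (Γ : MetricGraph V) : Type _ := Γ.Edge → ℝ → ℝ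

/-- Lebesgue measure on the edge `e`. -/
abbrev edgeMeasure (Γ : MetricGraph V) (e : Γ.Edge) : Measure ℝ :=
  intervalMeasure (Γ.edgeLength e)

/-- The characteristic function of a set. -/
def char (Γ : MetricGraph V) (A : Set Γ.Point) : Γ.Fn :=
  fun e => (Γ.coords A e).indicator 1

/-- `u ∈ L²(Γ)`. -/
def MemL2 (Γ : MetricGraph V) (u : Γ.Fn) : Prop := ∀ e, MemLp (u e) 2 (Γ.edgeMeasure e)

/-- `u ∈ BV(Γ)`. -/
def MemBV (Γ : MetricGraph V) (u : Γ.Fn) : Prop := ∀ e, MemBVInterval (Γ.edgeLength e) (u e)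

open Classical in
/-- The boundary value `[z]_e(v)` of `z` at an end `v` of `e`: `z(ℓ_e)` at the terminal vertex
and `-z(0)` at the initial vertex. -/
def flux (Γ : MetricGraph V) (z : Γ.Fn) (e : Γ.Edge) (v : V) : ℝ :=
  if v = Γ.terminal e then z e (Γ.edgeLength e) else -z e 0

section Compact

variable [Finite V]

/-- The length of a set. -/
def length (Γ : MetricGraph V) (A : Set Γ.Point) : ℝ≥0∞ := ∑ e : Γ.Edge, volume (Γ.coords A e)

/-- The integral over the metric graph. -/
def integral (Γ : MetricGraph V) (u : Γ.Fn) : ℝ := ∑ e : Γ.Edge, ∫ t, u e t ∂(Γ.edgeMeasure e)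

open Classical in
/-- `z` is (the continuous representative, edge by edge, of) an element of `X_K(Γ)` with weak
derivative `dz`: it belongs to `W^{1,2}(Γ)` and satisfies the Kirchhoff condition
`∑_{e ∋ v} [z]_e(v) = 0` at every vertex `v`. -/
def MemXK (Γ : MetricGraph V) (z dz : Γ.Fn) : Prop :=
  (∀ e, IsSobolevRep (Γ.edgeLength e) (z e) (dz e)) ∧
    ∀ v : V, ∑ e : Γ.Edge, (if v ∈ (e : Sym2 V) then Γ.flux z e v else 0) = 0

/-- The total variation
`TV_Γ(u) = sup { |∫_Γ u z'| : z ∈ X_K(Γ), ‖z‖_∞ ≤ 1 }`, for `u ∈ BV(Γ)`. -/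
def totalVariation (Γ : MetricGraph V) (u : Γ.Fn) : ℝ≥0∞ :=
  ⨆ (z : Γ.Fn) (dz : Γ.Fn) (_ : Γ.MemXK z dz) (_ : ∀ e, eLpNorm (z e) ∞ (Γ.edgeMeasure e) ≤ 1),
    ENNReal.ofReal |Γ.integral fun e t => u e t * dz e t|

/-- Sets of finite perimeter. -/
def HasFinitePerimeter (Γ : MetricGraph V) (A : Set Γ.Point) : Prop :=
  Γ.IsMeasurable A ∧ Γ.MemBV (Γ.char A)

/-- The `Γ`-perimeter, for sets of finite perimeter. -/
def perimeter (Γ : MetricGraph V) (A : Set Γ.Point) : ℝ≥0∞ := Γ.totalVariation (Γ.char A)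

/-! ### The Cheeger problem -/

/-- The `Γ`-Cheeger constant
`h₁(Ω) = inf { Per_Γ(E) / ℓ(E) : E ⊆ Ω of finite perimeter, ℓ(E) > 0 }`. -/
def cheegerConstant (Γ : MetricGraph V) (Ω : Set Γ.Point) : ℝ≥0∞ :=
  ⨅ (E : Set Γ.Point) (_ : E ⊆ Ω) (_ : Γ.HasFinitePerimeter E) (_ : 0 < Γ.length E),
    Γ.perimeter E / Γ.length E

/-- `E` is a `Γ`-Cheeger set of `Ω`: it is admissible for the infimum and attains it. -/
def IsCheegerSet (Γ : MetricGraph V) (Ω E : Set Γ.Point) : Prop :=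
  E ⊆ Ω ∧ Γ.HasFinitePerimeter E ∧ 0 < Γ.length E ∧
    Γ.cheegerConstant Ω = Γ.perimeter E / Γ.length E

/-- `Ω` is `Γ`-calibrable: it is a `Γ`-Cheeger set of itself. -/
def IsCalibrable (Γ : MetricGraph V) (Ω : Set Γ.Point) : Prop := Γ.IsCheegerSet Ω Ω

/-- `λ_Ω = Per_Γ(Ω) / ℓ(Ω)`. -/
def cheegerRatio (Γ : MetricGraph V) (Ω : Set Γ.Point) : ℝ :=
  (Γ.perimeter Ω).toReal / (Γ.length Ω).toReal

/-! ### The `1`-Laplacian and its eigenpairs -/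

open Classical in
/-- The energy functional on `L²(Γ)`: the total variation on `BV(Γ)` and `+∞` elsewhere. -/
def energy (Γ : MetricGraph V) (u : Γ.Fn) : ℝ≥0∞ :=
  if Γ.MemBV u then Γ.totalVariation u else ∞

/-- The subdifferential in `L²(Γ)` of the energy functional at `u`. -/
def subdifferential (Γ : MetricGraph V) (u : Γ.Fn) : Set Γ.Fn :=
  {v | Γ.MemL2 u ∧ Γ.MemL2 v ∧ ∀ w : Γ.Fn, Γ.MemL2 w →
    (Γ.energy u : EReal) + ((Γ.integral fun e t => v e t * (w e t - u e t) : ℝ) : EReal)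
      ≤ (Γ.energy w : EReal)}

/-- The `1`-Laplacian, a multivalued operator on `L²(Γ)`:
`(u, v) ∈ Δ₁` if and only if `-v ∈ ∂F(u)`. -/
def oneLaplacian (Γ : MetricGraph V) : Set (Γ.Fn × Γ.Fn) :=
  {p | -p.2 ∈ Γ.subdifferential p.1}

/-- `(l, u)` is a `Γ`-eigenpair of `-Δ₁`: `u ∈ BV(Γ)`, `‖u‖_{L¹(Γ)} = 1`, and there is
`ξ ∈ sign(u)` with `l ξ ∈ -Δ₁ u`. -/
def IsEigenpair (Γ : MetricGraph V) (l : ℝ) (u : Γ.Fn) : Prop :=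
  Γ.MemBV u ∧ Γ.integral (fun e t => |u e t|) = 1 ∧
    ∃ ξ : Γ.Fn, (∀ e, ∀ᵐ t ∂(Γ.edgeMeasure e), ξ e t ∈ signSet (u e t)) ∧
      (u, -(l • ξ)) ∈ Γ.oneLaplacian

end Compact

end MetricGraph

end

/-!
The energy `F` is absolutely homogeneous of degree one, so testing the subgradient inequality at
`w = 0` and `w = 2u` gives Euler's identity `∫ v u = F(u)` for `v ∈ ∂F(u)`, and the subgradient
inequality becomes `∫ v w ≤ F(w)` for all `w`. In particular `∂F(c u) = ∂F(u)` for `c > 0`.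
If `v = l ξ` is a subgradient at `χ_Ω` with `ξ = 1` on `Ω`, then testing it against `χ_E` for
`E ⊆ Ω` gives `l ℓ(E) ≤ Per(E)`, with equality for `E = Ω`; hence `l = Per(Ω) / ℓ(Ω)` is the
Cheeger constant.
-/

instance isFiniteMeasure_intervalMeasure (L : ℝ) : IsFiniteMeasure (intervalMeasure L) :=
  inferInstanceAs (IsFiniteMeasure (volume.restrict (Ioo 0 L)))

theorem IsTestFunction.integrable {L : ℝ} {φ : ℝ → ℝ} (hφ : IsTestFunction L φ) (μ : Measure ℝ)
    [IsFiniteMeasureOnCompacts μ] : Integrable φ μ :=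
  hφ.1.continuous.integrable_of_hasCompactSupport hφ.2.1

theorem MemBVInterval.const_smul {L : ℝ} {f : ℝ → ℝ} (hf : MemBVInterval L f) (c : ℝ) :
    MemBVInterval L (c • f) := by
  obtain ⟨hf1, μ, ν, hμ, hν, hderiv⟩ := hf
  -- Multiplication by a negative constant exchanges the two parts of the derivative.
  refine ⟨hf1.const_smul c, c.toNNReal • μ + (-c).toNNReal • ν,
    c.toNNReal • ν + (-c).toNNReal • μ, inferInstance, inferInstance, fun φ hφ => ?_⟩
  have hsplit : (c.toNNReal : ℝ) - (-c).toNNReal = c := by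
    simpa only [Real.coe_toNNReal'] using max_zero_sub_max_neg_zero_eq_self c
  rw [integral_add_measure (hφ.integrable _) (hφ.integrable _),
    integral_add_measure (hφ.integrable _) (hφ.integrable _)]
  simp only [Pi.smul_apply, smul_eq_mul, mul_assoc, integral_const_mul, hderiv φ hφ,
    integral_smul_nnreal_measure, NNReal.smul_def]
  linear_combination ((∫ t, φ t ∂μ) - ∫ t, φ t ∂ν) * hsplit

theorem signSet_of_pos {r : ℝ} (hr : 0 < r) : signSet r = {1} := if_pos hr

namespace MetricGraph

variable {V : Type*} {Γ : MetricGraph V}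

theorem coords_mono {A B : Set Γ.Point} (h : A ⊆ B) (e : Γ.Edge) :
    Γ.coords A e ⊆ Γ.coords B e :=
  fun _ ⟨ht, hA⟩ => ⟨ht, h hA⟩

theorem coords_subset_Icc (A : Set Γ.Point) (e : Γ.Edge) :
    Γ.coords A e ⊆ Icc 0 (Γ.edgeLength e) :=
  fun _ ⟨ht, _⟩ => ht

theorem volume_coords_ne_top (A : Set Γ.Point) (e : Γ.Edge) : volume (Γ.coords A e) ≠ ⊤ :=
  measure_ne_top_of_subset (coords_subset_Icc A e) measure_Icc_lt_top.ne

theorem edgeMeasure_coords (A : Set Γ.Point) (e : Γ.Edge) :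
    Γ.edgeMeasure e (Γ.coords A e) = volume (Γ.coords A e) := by
  rw [edgeMeasure, intervalMeasure, Measure.restrict_congr_set Ioo_ae_eq_Icc,
    Measure.restrict_eq_self _ (coords_subset_Icc A e)]

theorem IsMeasurable.nullMeasurableSet_coords {A : Set Γ.Point} (hA : Γ.IsMeasurable A)
    (e : Γ.Edge) : NullMeasurableSet (Γ.coords A e) (Γ.edgeMeasure e) :=
  (hA e).mono_ac Measure.absolutelyContinuous_restrict

theorem char_of_mem {A : Set Γ.Point} {e : Γ.Edge} {t : ℝ} (ht : t ∈ Γ.coords A e) :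
    Γ.char A e t = 1 :=
  indicator_of_mem ht 1

theorem char_of_notMem {A : Set Γ.Point} {e : Γ.Edge} {t : ℝ} (ht : t ∉ Γ.coords A e) :
    Γ.char A e t = 0 :=
  indicator_of_notMem ht 1

theorem memL2_char {A : Set Γ.Point} (hA : Γ.IsMeasurable A) : Γ.MemL2 (Γ.char A) := fun e =>
  (memLp_const (1 : ℝ)).mono
    (aestronglyMeasurable_one.indicator₀ (hA.nullMeasurableSet_coords e))
    (ae_of_all _ fun t => norm_indicator_le_norm_self 1 t)

theorem integral_char_edge {A : Set Γ.Point} (hA : Γ.IsMeasurable A) (e : Γ.Edge) :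
    ∫ t, Γ.char A e t ∂(Γ.edgeMeasure e) = (volume (Γ.coords A e)).toReal := by
  have h := integral_indicator₀ (f := fun _ => (1 : ℝ)) (hA.nullMeasurableSet_coords e)
  rw [setIntegral_const, smul_eq_mul, mul_one, measureReal_def, edgeMeasure_coords] at h
  exact h

theorem MemL2.const_smul {u : Γ.Fn} (hu : Γ.MemL2 u) (c : ℝ) : Γ.MemL2 (c • u) :=
  fun e => (hu e).const_smul c

theorem memL2_const_smul_iff {u : Γ.Fn} {c : ℝ} (hc : c ≠ 0) :
    Γ.MemL2 (c • u) ↔ Γ.MemL2 u :=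
  ⟨fun h => inv_smul_smul₀ hc u ▸ h.const_smul c⁻¹, fun h => h.const_smul c⟩

theorem MemBV.const_smul {u : Γ.Fn} (hu : Γ.MemBV u) (c : ℝ) : Γ.MemBV (c • u) :=
  fun e => (hu e).const_smul c

theorem memBV_const_smul_iff {u : Γ.Fn} {c : ℝ} (hc : c ≠ 0) :
    Γ.MemBV (c • u) ↔ Γ.MemBV u :=
  ⟨fun h => inv_smul_smul₀ hc u ▸ h.const_smul c⁻¹, fun h => h.const_smul c⟩

theorem memBV_zero : Γ.MemBV 0 :=
  fun _ => ⟨MemLp.zero, 0, 0, inferInstance, inferInstance, by simp⟩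

variable [Finite V]

theorem length_ne_top (A : Set Γ.Point) : Γ.length A ≠ ⊤ :=
  ENNReal.sum_ne_top.2 fun e _ => volume_coords_ne_top A e

theorem ofReal_mul_length (l : ℝ) (A : Set Γ.Point) :
    ENNReal.ofReal (l * (Γ.length A).toReal) = ENNReal.ofReal l * Γ.length A := by
  rw [ENNReal.ofReal_mul' ENNReal.toReal_nonneg, ENNReal.ofReal_toReal (length_ne_top A)]

theorem integral_const_mul (c : ℝ) (u : Γ.Fn) :
    (Γ.integral fun e t => c * u e t) = c * Γ.integral u := by
  simp only [integral, MeasureTheory.integral_const_mul, Finset.mul_sum]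

theorem integral_mul_const_smul (c : ℝ) (u v : Γ.Fn) :
    (Γ.integral fun e t => v e t * (c • u) e t) = c * Γ.integral fun e t => v e t * u e t := by
  simp only [Pi.smul_apply, smul_eq_mul, mul_left_comm _ c]
  exact integral_const_mul c fun e t => v e t * u e t

theorem integral_mul_sub {u v w : Γ.Fn} (hv : Γ.MemL2 v) (hu : Γ.MemL2 u) (hw : Γ.MemL2 w) :
    (Γ.integral fun e t => v e t * (w e t - u e t)) =
      (Γ.integral fun e t => v e t * w e t) - Γ.integral fun e t => v e t * u e t := by
  simp only [integral, ← Finset.sum_sub_distrib, mul_sub]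
  exact Finset.sum_congr rfl fun e _ =>
    integral_sub ((hv e).integrable_mul (hw e)) ((hv e).integrable_mul (hu e))

theorem integral_char {A : Set Γ.Point} (hA : Γ.IsMeasurable A) :
    Γ.integral (Γ.char A) = (Γ.length A).toReal := by
  rw [length, ENNReal.toReal_sum fun e _ => volume_coords_ne_top A e]
  exact Finset.sum_congr rfl fun e _ => integral_char_edge hA e

theorem integral_mul_char {A : Set Γ.Point} (hA : Γ.IsMeasurable A) {v : Γ.Fn} {l : ℝ}
    (hv : ∀ e, ∀ᵐ t ∂(Γ.edgeMeasure e), t ∈ Γ.coords A e → v e t = l) :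
    (Γ.integral fun e t => v e t * Γ.char A e t) = l * (Γ.length A).toReal := by
  rw [← integral_char hA, ← integral_const_mul]
  refine Finset.sum_congr rfl fun e _ => integral_congr_ae ?_
  filter_upwards [hv e] with t ht
  by_cases hmem : t ∈ Γ.coords A e
  · rw [ht hmem]
  · simp only [char_of_notMem hmem, mul_zero]

theorem totalVariation_const_smul (c : ℝ) (u : Γ.Fn) :
    Γ.totalVariation (c • u) = ENNReal.ofReal |c| * Γ.totalVariation u := by
  have hpairing (dz : Γ.Fn) : ENNReal.ofReal |Γ.integral fun e t => (c • u) e t * dz e t| =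
      ENNReal.ofReal |c| * ENNReal.ofReal |Γ.integral fun e t => u e t * dz e t| := by
    simp only [Pi.smul_apply, smul_eq_mul, mul_assoc]
    rw [integral_const_mul c fun e t => u e t * dz e t, abs_mul, ENNReal.ofReal_mul (abs_nonneg c)]
  simp only [totalVariation, hpairing, ENNReal.mul_iSup]

theorem energy_of_memBV {u : Γ.Fn} (hu : Γ.MemBV u) : Γ.energy u = Γ.totalVariation u :=
  if_pos hu

theorem energy_of_not_memBV {u : Γ.Fn} (hu : ¬Γ.MemBV u) : Γ.energy u = ⊤ :=
  if_neg hu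

theorem memBV_of_energy_ne_top {u : Γ.Fn} (hu : Γ.energy u ≠ ⊤) : Γ.MemBV u :=
  by_contra fun h => hu (energy_of_not_memBV h)

theorem energy_zero : Γ.energy 0 = 0 := by
  rw [energy_of_memBV memBV_zero, ← zero_smul ℝ (0 : Γ.Fn), totalVariation_const_smul]
  simp only [abs_zero, ENNReal.ofReal_zero, zero_mul]

theorem energy_const_smul (c : ℝ) (u : Γ.Fn) :
    Γ.energy (c • u) = ENNReal.ofReal |c| * Γ.energy u := by
  obtain rfl | hc := eq_or_ne c 0
  · simp only [zero_smul, energy_zero, abs_zero, ENNReal.ofReal_zero, zero_mul]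
  by_cases hu : Γ.MemBV u
  · rw [energy_of_memBV hu, energy_of_memBV (hu.const_smul c), totalVariation_const_smul]
  · rw [energy_of_not_memBV hu, energy_of_not_memBV (mt (memBV_const_smul_iff hc).1 hu),
      ENNReal.mul_top (ENNReal.ofReal_pos.2 (abs_pos.2 hc)).ne']

theorem integral_mul_self_eq_energy_of_mem_subdifferential {u v : Γ.Fn}
    (hv : v ∈ Γ.subdifferential u) :
    ((Γ.integral fun e t => v e t * u e t : ℝ) : EReal) = Γ.energy u := by
  obtain ⟨hu2, hv2, hsub⟩ := hv
  set I := Γ.integral fun e t => v e t * u e t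
  have hray (c : ℝ) : (Γ.energy u : EReal) + (c * I - I : ℝ) ≤
      (ENNReal.ofReal |c| * Γ.energy u : ℝ≥0∞) := by
    have h := hsub (c • u) (hu2.const_smul c)
    rwa [energy_const_smul, integral_mul_sub hv2 hu2 (hu2.const_smul c),
      integral_mul_const_smul] at h
  have hfin : Γ.energy u ≠ ⊤ := fun htop => by simpa [htop] using hray 0
  lift Γ.energy u to NNReal using hfin with F
  have hray_real (c : ℝ) : F + (c * I - I) ≤ |c| * F := by
    have h := hray c
    rw [EReal.coe_ennreal_mul, EReal.coe_ennreal_ofReal, max_eq_left (abs_nonneg c),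
      EReal.coe_nnreal_eq_coe_real] at h
    exact_mod_cast h
  have hle : F ≤ I := by simpa using hray_real 0
  have hge : I ≤ F := by
    have h := hray_real 2
    rw [abs_two] at h
    linarith
  exact congrArg Real.toEReal (hge.antisymm hle)

theorem mem_subdifferential_iff {u v : Γ.Fn} :
    v ∈ Γ.subdifferential u ↔ Γ.MemL2 u ∧ Γ.MemL2 v ∧
      ((Γ.integral fun e t => v e t * u e t : ℝ) : EReal) = Γ.energy u ∧
      ∀ w, Γ.MemL2 w → ((Γ.integral fun e t => v e t * w e t : ℝ) : EReal) ≤ Γ.energy w := by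
  constructor
  · intro hv
    have heuler := integral_mul_self_eq_energy_of_mem_subdifferential hv
    obtain ⟨hu2, hv2, hsub⟩ := hv
    refine ⟨hu2, hv2, heuler, fun w hw => ?_⟩
    have h := hsub w hw
    rwa [← heuler, integral_mul_sub hv2 hu2 hw, ← EReal.coe_add, add_sub_cancel] at h
  · rintro ⟨hu2, hv2, heuler, hle⟩
    refine ⟨hu2, hv2, fun w hw => ?_⟩
    rw [← heuler, integral_mul_sub hv2 hu2 hw, ← EReal.coe_add, add_sub_cancel]
    exact hle w hw

theorem subdifferential_const_smul {c : ℝ} (hc : 0 < c) (u : Γ.Fn) :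
    Γ.subdifferential (c • u) = Γ.subdifferential u := by
  ext v
  have hcancel (x : ℝ) (a : ℝ≥0∞) :
      ((c * x : ℝ) : EReal) = (ENNReal.ofReal c * a : ℝ≥0∞) ↔ (x : EReal) = a := by
    rw [EReal.coe_ennreal_mul, EReal.coe_ennreal_ofReal, max_eq_left hc.le]
    induction a with
    | top => simp [EReal.coe_mul_top_of_pos hc, -EReal.coe_mul]
    | coe a =>
      rw [EReal.coe_nnreal_eq_coe_real, ← EReal.coe_mul, EReal.coe_eq_coe_iff,
        EReal.coe_eq_coe_iff, mul_right_inj' hc.ne']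
  rw [mem_subdifferential_iff, mem_subdifferential_iff, memL2_const_smul_iff hc.ne',
    integral_mul_const_smul, energy_const_smul, abs_of_pos hc, hcancel]

theorem isCalibrable_of_forall_div_le {Ω : Set Γ.Point} (hΩ : Γ.HasFinitePerimeter Ω)
    (hpos : 0 < Γ.length Ω)
    (hle : ∀ E ⊆ Ω, Γ.HasFinitePerimeter E → 0 < Γ.length E →
      Γ.perimeter Ω / Γ.length Ω ≤ Γ.perimeter E / Γ.length E) :
    Γ.IsCalibrable Ω :=
  ⟨Subset.rfl, hΩ, hpos, le_antisymm
    (iInf₂_le_of_le Ω Subset.rfl (iInf₂_le_of_le hΩ hpos le_rfl))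
    (le_iInf₂ fun E hEΩ => le_iInf₂ (hle E hEΩ))⟩

theorem ofReal_mul_length_le_energy_char_of_mem_subdifferential {u v : Γ.Fn} {E : Set Γ.Point}
    {l : ℝ} (hE : Γ.IsMeasurable E) (hv : v ∈ Γ.subdifferential u)
    (hvE : ∀ e, ∀ᵐ t ∂(Γ.edgeMeasure e), t ∈ Γ.coords E e → v e t = l) :
    ENNReal.ofReal l * Γ.length E ≤ Γ.energy (Γ.char E) := by
  have h := (mem_subdifferential_iff.1 hv).2.2.2 _ (memL2_char hE)
  rw [integral_mul_char hE hvE] at h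
  simpa only [EReal.real_coe_toENNReal, EReal.toENNReal_coe, ofReal_mul_length] using
    EReal.toENNReal_le_toENNReal h

section CharSubgradient

variable {Ω : Set Γ.Point} {v : Γ.Fn} {l : ℝ}

theorem hasFinitePerimeter_of_mem_subdifferential (hΩ : Γ.IsMeasurable Ω)
    (hv : v ∈ Γ.subdifferential (Γ.char Ω)) : Γ.HasFinitePerimeter Ω := by
  have heuler := integral_mul_self_eq_energy_of_mem_subdifferential hv
  exact ⟨hΩ, memBV_of_energy_ne_top fun htop => by simp [htop] at heuler⟩

theorem mul_length_eq_perimeter_of_mem_subdifferential (hΩ : Γ.IsMeasurable Ω)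
    (hv : v ∈ Γ.subdifferential (Γ.char Ω))
    (hvΩ : ∀ e, ∀ᵐ t ∂(Γ.edgeMeasure e), t ∈ Γ.coords Ω e → v e t = l) :
    ((l * (Γ.length Ω).toReal : ℝ) : EReal) = Γ.perimeter Ω := by
  rw [perimeter, ← energy_of_memBV (hasFinitePerimeter_of_mem_subdifferential hΩ hv).2,
    ← integral_mul_char hΩ hvΩ, integral_mul_self_eq_energy_of_mem_subdifferential hv]

theorem eq_cheegerRatio_of_mem_subdifferential (hΩ : Γ.IsMeasurable Ω) (hpos : 0 < Γ.length Ω)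
    (hv : v ∈ Γ.subdifferential (Γ.char Ω))
    (hvΩ : ∀ e, ∀ᵐ t ∂(Γ.edgeMeasure e), t ∈ Γ.coords Ω e → v e t = l) :
    l = Γ.cheegerRatio Ω := by
  have hPer : l * (Γ.length Ω).toReal = (Γ.perimeter Ω).toReal := by
    simpa only [EReal.toReal_coe, EReal.toReal_coe_ennreal] using
      congrArg EReal.toReal (mul_length_eq_perimeter_of_mem_subdifferential hΩ hv hvΩ)
  exact eq_div_of_mul_eq (ENNReal.toReal_pos hpos.ne' (length_ne_top Ω)).ne' hPer

theorem isCalibrable_of_mem_subdifferential (hΩ : Γ.IsMeasurable Ω) (hpos : 0 < Γ.length Ω)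
    (hv : v ∈ Γ.subdifferential (Γ.char Ω))
    (hvΩ : ∀ e, ∀ᵐ t ∂(Γ.edgeMeasure e), t ∈ Γ.coords Ω e → v e t = l) :
    Γ.IsCalibrable Ω := by
  refine isCalibrable_of_forall_div_le (hasFinitePerimeter_of_mem_subdifferential hΩ hv) hpos
    fun E hEΩ hE hEpos => ?_
  have hPerΩ : Γ.perimeter Ω = ENNReal.ofReal l * Γ.length Ω := by
    simpa only [EReal.real_coe_toENNReal, EReal.toENNReal_coe, ofReal_mul_length] using
      congrArg EReal.toENNReal (mul_length_eq_perimeter_of_mem_subdifferential hΩ hv hvΩ).symm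
  have hPerE : ENNReal.ofReal l * Γ.length E ≤ Γ.perimeter E := by
    rw [perimeter, ← energy_of_memBV hE.2]
    exact ofReal_mul_length_le_energy_char_of_mem_subdifferential hE.1 hv fun e =>
      (hvΩ e).mono fun t ht htE => ht (coords_mono hEΩ e htE)
  rw [hPerΩ, ENNReal.mul_div_cancel_right hpos.ne' (length_ne_top Ω)]
  exact (ENNReal.le_div_iff_mul_le (.inl hEpos.ne') (.inl (length_ne_top E))).2 hPerE

end CharSubgradient

end MetricGraph

open MetricGraph in
theorem mainTheorem11_general {V : Type*} [Finite V] (Γ : MetricGraph V) (Ω : Set Γ.Point)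
    (hΩ : Γ.IsMeasurable Ω) (hpos : 0 < Γ.length Ω) {l : ℝ}
    (hpair : Γ.IsEigenpair l ((Γ.length Ω).toReal⁻¹ • Γ.char Ω)) :
    l = Γ.cheegerRatio Ω ∧ Γ.IsCalibrable Ω := by
  obtain ⟨-, -, ξ, hξ, hsub⟩ := hpair
  have hc : 0 < (Γ.length Ω).toReal⁻¹ :=
    inv_pos.2 (ENNReal.toReal_pos hpos.ne' (length_ne_top Ω))
  have hv : l • ξ ∈ Γ.subdifferential (Γ.char Ω) := by
    rwa [oneLaplacian, mem_ofPred_eq, neg_neg, subdifferential_const_smul hc] at hsub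
  have hvΩ (e) : ∀ᵐ t ∂(Γ.edgeMeasure e), t ∈ Γ.coords Ω e → (l • ξ) e t = l := by
    filter_upwards [hξ e] with t ht htΩ
    simp only [Pi.smul_apply, smul_eq_mul, char_of_mem htΩ, mul_one, signSet_of_pos hc,
      mem_singleton_iff] at ht ⊢
    rw [ht, mul_one]
  exact ⟨eq_cheegerRatio_of_mem_subdifferential hΩ hpos hv hvΩ,
    isCalibrable_of_mem_subdifferential hΩ hpos hv hvΩ⟩

theorem mainTheorem11 {V : Type*} [Finite V] (Γ : MetricGraph V) (Ω : Set Γ.Point)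
    (hΩ : Γ.IsMeasurable Ω) (hpos : 0 < Γ.length Ω)
    (hpair : Γ.IsEigenpair (Γ.cheegerRatio Ω) ((Γ.length Ω).toReal⁻¹ • Γ.char Ω)) :
    Γ.IsCalibrable Ω :=
  (mainTheorem11_general Γ Ω hΩ hpos hpair).2
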